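/- Let $k,d\ge 1$, and let $X_{ij}$ ($i=1,\dots,k$, $j=1,2,\dots$) be mutually independent $\mathbb R^d$-valued random vectors such that, for each group $i$, all $X_{ij}$ have the same distribution. Assume $\mathbb E(X_{i1r}^4)<\infty$ for every group $i$ and coordinate $r$, that the mean vector $\mu_i=\mathbb E(X_{i1})$ is nonzero, and that the covariance matrix $\Sigma_i=\operatorname{Cov}(X_{i1})$ is nonsingular. Group $i$ is observed for $j=1,\dots,n_i$; put $n=\sum_{i=1}^k n_i$, and assume that $n\to\infty$ with $n_i/n\to\kappa_i\in(0,1)$ for every $i$. Let $$\widehat\mu_i=\frac1{n_i}\sum_{j=1}^{n_i}X_{ij},\qquad \widehat\Sigma_i=\frac1{n_i}\sum_{j=1}^{n_i}(X_{ij}-\widehat\mu_i)(X_{ij}-\widehat\mu_i)^\top,$$ $$C_i=(\mu_i^\top\Sigma_i^{-1}\mu_i)^{-1/2},\quad B_i=(\mu_i^\top\Sigma_i^{-1}\mu_i)^{1/2},\quad \widehat C_i=(\widehat\mu_i^\top\widehat\Sigma_i^{-1}\widehat\mu_i)^{-1/2},\quad \widehat B_i=(\widehat\mu_i^\top\widehat\Sigma_i^{-1}\widehat\mu_i)^{1/2},$$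 where the estimators are given the value $0$ where the formula is undefined; this happens with probability tending to $0$. For $x\in\mathbb R^d$ let $\widetilde D(x)\in\mathbb R^{d^2\times d}$, and let $\Psi_{i3}\in\mathbb R^{d^2\times d}$, $\Psi_{i4}\in\mathbb R^{d^2\times d^2}$, have the entries (for $a,b,r,s\in\{1,\dots,d\}$) $$[\widetilde D(x)]_{ad-d+r,\,s}=-x_r\mathbf 1\{s=a\ne r\}-2x_s\mathbf 1\{s=r=a\}-x_a\mathbf 1\{r=s\ne a\},$$ $$[\Psi_{i3}]_{ad-d+r,\,s}=\mathbb E(X_{i1a}X_{i1r}X_{i1s})-\mathbb E(X_{i1a}X_{i1r})\,\mathbb E(X_{i1s}),$$ $$[\Psi_{i4}]_{ad-d+r,\,bd-d+s}=\mathbb E(X_{i1a}X_{i1r}X_{i1b}X_{i1s})-\mathbb E(X_{i1a}X_{i1r})\,\mathbb E(X_{i1b}X_{i1s}).$$ With $w_i=\mu_i^\top\Sigma_i^{-1}$ (a row vector) let $A(\mu_i,\Sigma_i)$ be the row vector of length $d+d^2$ $$A(\mu_i,\Sigma_i)=\begin{pmatrix}2w_i-(w_i\otimes w_i)\widetilde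 D(\mu_i) & \;-\,w_i\otimes w_i\end{pmatrix}.$$ Then, for every $i$: (i) $\sqrt n\,(\widehat C_i-C_i)$ converges in distribution to $N(0,\sigma_{i,C}^2)$, where $$\sigma_{i,C}^2=\frac1{4\kappa_i}(\mu_i^\top\Sigma_i^{-1}\mu_i)^{-3}\,A(\mu_i,\Sigma_i)\begin{pmatrix}\Sigma_i&\Psi_{i3}^\top\\ \Psi_{i3}&\Psi_{i4}\end{pmatrix}A(\mu_i,\Sigma_i)^\top\ \ge 0 .$$ (ii) $\sqrt n\,(\widehat B_i-B_i)$ converges in distribution to $N(0,\sigma_{i,B}^2)$, where $\sigma_{i,B}^2=(\mu_i^\top\Sigma_i^{-1}\mu_i)^2\,\sigma_{i,C}^2$. The variances may be $0$, in which case the limit is the point mass at $0$. -/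

import Mathlib

open MeasureTheory ProbabilityTheory Filter Topology

namespace MCV

noncomputable section

variable {Ω : Type*} [MeasurableSpace Ω] {d : ℕ}

/-- The scalar `xᵀ S⁻¹ x`. -/
def quad (x : Fin d → ℝ) (S : Matrix (Fin d) (Fin d) ℝ) : ℝ :=
  x ⬝ᵥ (S⁻¹).mulVec x

/-- The multivariate coefficient of variation `1 / √(xᵀ S⁻¹ x)`. -/
def coefVar (x : Fin d → ℝ) (S : Matrix (Fin d) (Fin d) ℝ) : ℝ :=
  1 / √(quad x S)

/-- The standardized mean `√(xᵀ S⁻¹ x)`. -/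
def stdMean (x : Fin d → ℝ) (S : Matrix (Fin d) (Fin d) ℝ) : ℝ :=
  √(quad x S)

/-- The expectation vector of the random vector `Y`. -/
def mean (Y : Ω → Fin d → ℝ) (P : Measure Ω) : Fin d → ℝ :=
  fun r => ∫ ω, Y ω r ∂P

/-- The covariance matrix of the random vector `Y`. -/
def covMat (Y : Ω → Fin d → ℝ) (P : Measure Ω) : Matrix (Fin d) (Fin d) ℝ :=
  Matrix.of fun r s => cov[fun ω => Y ω r, fun ω => Y ω s; P]

/-- The empirical mean of the observations `x 0, …, x (m - 1)`. -/
def sampleMean (m : ℕ) (x : ℕ → Fin d → ℝ) : Fin d → ℝ :=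
  fun r => (1 / (m : ℝ)) * ∑ j ∈ Finset.range m, x j r

/-- The empirical covariance matrix (with normalization `1 / m`) of `x 0, …, x (m - 1)`. -/
def sampleCov (m : ℕ) (x : ℕ → Fin d → ℝ) : Matrix (Fin d) (Fin d) ℝ :=
  Matrix.of fun r s => (1 / (m : ℝ)) *
    ∑ j ∈ Finset.range m, (x j r - sampleMean m x r) * (x j s - sampleMean m x s)

/-- The `d² × d` matrix `D̃(x)`; the row with number `a d - d + r` is indexed by `(a, r)`. -/
def Dtilde (x : Fin d → ℝ) : Matrix (Fin d × Fin d) (Fin d) ℝ :=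
  Matrix.of fun p s =>
    - (if s = p.1 ∧ p.1 ≠ p.2 then x p.2 else 0)
    - (if s = p.2 ∧ p.2 = p.1 then 2 * x s else 0)
    - (if p.2 = s ∧ s ≠ p.1 then x p.1 else 0)

/-- `Ψ₃`: the covariances between the products `Y_a Y_r` and the coordinates `Y_s`. -/
def Psi3 (Y : Ω → Fin d → ℝ) (P : Measure Ω) : Matrix (Fin d × Fin d) (Fin d) ℝ :=
  Matrix.of fun p s =>
    (∫ ω, Y ω p.1 * Y ω p.2 * Y ω s ∂P) - (∫ ω, Y ω p.1 * Y ω p.2 ∂P) * ∫ ω, Y ω s ∂P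

/-- `Ψ₄`: the covariances between the products `Y_a Y_r` and `Y_b Y_s`. -/
def Psi4 (Y : Ω → Fin d → ℝ) (P : Measure Ω) :
    Matrix (Fin d × Fin d) (Fin d × Fin d) ℝ :=
  Matrix.of fun p q =>
    (∫ ω, Y ω p.1 * Y ω p.2 * Y ω q.1 * Y ω q.2 ∂P)
      - (∫ ω, Y ω p.1 * Y ω p.2 ∂P) * ∫ ω, Y ω q.1 * Y ω q.2 ∂P

/-- The joint covariance matrix of the first and second order monomials of `Y`. -/
def jointCov (Y : Ω → Fin d → ℝ) (P : Measure Ω) :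
    Matrix (Fin d ⊕ Fin d × Fin d) (Fin d ⊕ Fin d × Fin d) ℝ :=
  Matrix.fromBlocks (covMat Y P) (Psi3 Y P).transpose (Psi3 Y P) (Psi4 Y P)

/-- The Kronecker product of two row vectors. -/
def kronVec (u v : Fin d → ℝ) : Fin d × Fin d → ℝ :=
  fun p => u p.1 * v p.2

/-- The row vector `A(x, S)` of length `d + d²`, with `w = xᵀ S⁻¹`:
its first block is `2 w - (w ⊗ w) D̃(x)` and its second block is `- w ⊗ w`. -/
def rowA (x : Fin d → ℝ) (S : Matrix (Fin d) (Fin d) ℝ) : Fin d ⊕ Fin d × Fin d → ℝ :=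
  let w : Fin d → ℝ := Matrix.vecMul x S⁻¹
  Sum.elim ((2 : ℝ) • w - Matrix.vecMul (kronVec w w) (Dtilde x)) (-(kronVec w w))

/-- The asymptotic variance `σ_C²` for a group with generic observation `Y` and limiting
sample proportion `κ`. -/
def asympVarC (Y : Ω → Fin d → ℝ) (P : Measure Ω) (κ : ℝ) : ℝ :=
  1 / (4 * κ) * (quad (mean Y P) (covMat Y P)) ^ (-3 : ℤ) *
    (Matrix.vecMul (rowA (mean Y P) (covMat Y P)) (jointCov Y P) ⬝ᵥ
      rowA (mean Y P) (covMat Y P))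

/-- The asymptotic variance `σ_B²`. -/
def asympVarB (Y : Ω → Fin d → ℝ) (P : Measure Ω) (κ : ℝ) : ℝ :=
  (quad (mean Y P) (covMat Y P)) ^ 2 * asympVarC Y P κ

/-- The plug-in estimator of the coefficient of variation from the first `m` observations. -/
def estC (m : ℕ) (x : ℕ → Fin d → ℝ) : ℝ :=
  coefVar (sampleMean m x) (sampleCov m x)

/-- The plug-in estimator of the standardized mean from the first `m` observations. -/
def estB (m : ℕ) (x : ℕ → Fin d → ℝ) : ℝ :=
  stdMean (sampleMean m x) (sampleCov m x)

end

end MCV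

/-!
Only the group `i` enters each claim, so let `Y j = X i j`, and let `θ` be the vector of means of all
monomials of degree one and two in the coordinates, with empirical version `θ̂`. The covariance
matrix is a function of `θ`, hence so is `q = μᵀ Σ⁻¹ μ`; write `q̂` for its plug-in estimator.

Instead of a multivariate central limit theorem and a multivariate delta method, the proof uses an
exact identity (`quad_sub_quad`): whenever the empirical covariance matrix is invertible,
`q̂ - q = ∑ k, Â k * (θ̂ k - θ k)`, with coefficients `Â` (`secantCoeff`) that are continuous in the
estimators and become the row vector `rowA` at the true parameter (`secantCoeff_diag`). By the
strong law of large numbers the empirical covariance matrix is almost surely eventually invertible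
and `Â` converges almost surely to `rowA`. Each `√n (θ̂ k - θ k)` is asymptotically normal, so by
Slutsky's theorem `Â` may be replaced by its limit, and what remains is the scalar central limit
theorem for `∑ k, rowA k * monomials (Y j) k`, whose variance is the quadratic form of `jointCov`
at `rowA` (`tendstoInDistribution_of_linearization`, `vecMul_jointCov_dotProduct`). The sum runs
over `n_i` and not over `n` observations, which gives the factor `1 / κ_i`.

Finally `q > 0` because the covariance matrix is positive definite, and the functions `1 / √q` and
`√q` are handled by the one-dimensional delta method, again through an exact identity
(`TendstoInDistribution.delta_method`).
-/

namespace MCV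

/-! ### Convergence in distribution: Slutsky-type lemmas and the delta method -/

section Convergence

variable {Ω Ω' Ω'' : Type*} [MeasurableSpace Ω] {P : Measure Ω} [IsProbabilityMeasure P]
  {mΩ' : MeasurableSpace Ω'} {mΩ'' : MeasurableSpace Ω''}
  {μ : Measure Ω'} [IsProbabilityMeasure μ] {ν : Measure Ω''} [IsProbabilityMeasure ν]

lemma TendstoInDistribution.of_map_eq {X : ℕ → Ω → ℝ} {Z : Ω' → ℝ} {W : Ω'' → ℝ}
    (h : TendstoInDistribution X atTop Z (fun _ => P) μ) (hW : AEMeasurable W ν)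
    (hZW : μ.map Z = ν.map W) : TendstoInDistribution X atTop W (fun _ => P) ν := by
  refine ⟨h.forall_aemeasurable, hW, ?_⟩
  have h' := h.tendsto
  have e : (⟨μ.map Z, Measure.isProbabilityMeasure_map h.aemeasurable_limit⟩ :
      ProbabilityMeasure ℝ) = ⟨ν.map W, Measure.isProbabilityMeasure_map hW⟩ :=
    Subtype.ext hZW
  rwa [e] at h'

lemma TendstoInDistribution.comp_tendsto {X : ℕ → Ω → ℝ} {Z : Ω' → ℝ}
    (h : TendstoInDistribution X atTop Z (fun _ => P) μ) {n : ℕ → ℕ}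
    (hn : Tendsto n atTop atTop) :
    TendstoInDistribution (fun m => X (n m)) atTop Z (fun _ => P) μ :=
  ⟨fun m => h.forall_aemeasurable (n m), h.aemeasurable_limit, h.tendsto.comp hn⟩

/-- Convergence in distribution to the constant `0` is convergence in probability: test against
the bounded continuous function `min |x| 1`. -/
lemma tendstoInMeasure_zero_of_tendstoInDistribution {X : ℕ → Ω → ℝ}
    (h : TendstoInDistribution X atTop (fun _ : Ω' => (0 : ℝ)) (fun _ => P) μ) :
    TendstoInMeasure P X atTop 0 := by
  have hX := h.forall_aemeasurable
  let g : BoundedContinuousFunction ℝ ℝ :=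
    BoundedContinuousFunction.mkOfBound ⟨fun x => min |x| 1, by fun_prop⟩ 1 (by
      intro x y
      have h1 : 0 ≤ min |x| 1 := by positivity
      have h2 : 0 ≤ min |y| 1 := by positivity
      have h3 := min_le_right |x| 1
      have h4 := min_le_right |y| 1
      simp only [ContinuousMap.coe_mk, Real.dist_eq]
      rw [abs_le]; constructor <;> linarith)
  have hg : ∀ x, g x = min |x| 1 := fun x => rfl
  have h1 := ProbabilityMeasure.tendsto_iff_forall_integral_tendsto.1 h.tendsto g
  simp only [ProbabilityMeasure.coe_mk] at h1
  rw [integral_map (by fun_prop) (by fun_prop)] at h1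
  have h2 : Tendsto (fun m => ∫ ω, g (X m ω) ∂P) atTop (𝓝 0) := by
    refine (h1.congr fun m => ?_).trans (by simp [hg])
    rw [integral_map (hX m) (by fun_prop)]
  rw [tendstoInMeasure_iff_measureReal_norm]
  intro ε hε
  have hδ : 0 < min ε 1 := by positivity
  refine squeeze_zero (g := fun m => (min ε 1)⁻¹ * ∫ ω, g (X m ω) ∂P)
    (fun m => measureReal_nonneg) (fun m => ?_) (by simpa using h2.const_mul (min ε 1)⁻¹)
  have hint : Integrable (fun ω => g (X m ω)) P :=
    Integrable.of_bound (by fun_prop) 1 (ae_of_all _ fun ω => by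
      rw [hg, Real.norm_of_nonneg (by positivity)]; exact min_le_right _ _)
  have h3 := mul_meas_ge_le_integral_of_nonneg (μ := P) (f := fun ω => g (X m ω))
    (ae_of_all _ fun ω => by simp only [hg, Pi.zero_apply]; positivity) hint (min ε 1)
  rw [← div_eq_inv_mul, le_div_iff₀ hδ, mul_comm]
  refine le_trans (mul_le_mul_of_nonneg_left (measureReal_mono fun ω hω => ?_) hδ.le) h3
  simp only [Set.mem_ofPred_eq, Pi.zero_apply, sub_zero, Real.norm_eq_abs] at hω
  simp only [Set.mem_ofPred_eq, hg]
  exact min_le_min_right _ hω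

/-- Slutsky: changing the variables by an almost surely negligible amount keeps the limit. -/
lemma TendstoInDistribution.of_ae_tendsto_sub {X Y : ℕ → Ω → ℝ} {Z : Ω' → ℝ}
    (h : TendstoInDistribution X atTop Z (fun _ => P) μ) (hY : ∀ m, AEMeasurable (Y m) P)
    (hXY : ∀ᵐ ω ∂P, Tendsto (fun m => Y m ω - X m ω) atTop (𝓝 0)) :
    TendstoInDistribution Y atTop Z (fun _ => P) μ := by
  have hX := h.forall_aemeasurable
  refine tendstoInDistribution_of_tendstoInMeasure_sub Y Z h ?_ hY
  exact tendstoInMeasure_of_tendsto_ae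
    (fun m => ((hY m).sub (hX m)).aestronglyMeasurable) hXY

lemma TendstoInDistribution.mul_of_ae_tendsto {X Y : ℕ → Ω → ℝ} {Z : Ω' → ℝ} {c : ℝ}
    (h : TendstoInDistribution X atTop Z (fun _ => P) μ) (hY : ∀ m, AEMeasurable (Y m) P)
    (hYc : ∀ᵐ ω ∂P, Tendsto (fun m => Y m ω) atTop (𝓝 c)) :
    TendstoInDistribution (fun m ω => Y m ω * X m ω) atTop (fun ω => c * Z ω)
      (fun _ => P) μ :=
  h.continuous_comp_prodMk_of_tendstoInMeasure_const (g := fun p : ℝ × ℝ => p.2 * p.1)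
    (by fun_prop)
    (tendstoInMeasure_of_tendsto_ae (fun m => (hY m).aestronglyMeasurable) hYc) hY

lemma TendstoInMeasure.zero_finsetSum {K : Type*} (s : Finset K) {R : K → ℕ → Ω → ℝ}
    (h : ∀ k, TendstoInMeasure P (R k) atTop 0) :
    TendstoInMeasure P (fun m ω => ∑ k ∈ s, R k m ω) atTop 0 := by
  classical
  induction s using Finset.induction_on with
  | empty =>
    refine tendstoInMeasure_of_tendsto_ae (fun _ => ?_) (ae_of_all _ fun _ => ?_)
    · simpa using aestronglyMeasurable_const
    · simp
  | insert k s hk ih =>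
    simp only [Finset.sum_insert hk]
    rw [tendstoInMeasure_iff_measureReal_norm] at ih ⊢
    have hk' := h k
    rw [tendstoInMeasure_iff_measureReal_norm] at hk'
    intro ε hε
    refine squeeze_zero (fun _ => measureReal_nonneg) (fun m => ?_)
      (by simpa using (hk' (ε / 2) (by positivity)).add (ih (ε / 2) (by positivity)))
    refine (measureReal_mono ?_).trans (measureReal_union_le _ _)
    intro ω hω
    simp only [Set.mem_union, Set.mem_ofPred_eq, Pi.zero_apply, sub_zero] at hω ⊢
    by_contra! hcon
    have := norm_add_le (R k m ω) (∑ k ∈ s, R k m ω)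
    simp only [Real.norm_eq_abs] at hω this
    linarith [hcon.1, hcon.2]

lemma map_const_mul_gaussianReal_zero (c v : ℝ) (hv : 0 ≤ v) :
    (gaussianReal 0 v.toNNReal).map (fun x => c * id x) =
      (gaussianReal 0 (c ^ 2 * v).toNNReal).map id := by
  simp only [id]
  rw [gaussianReal_map_const_mul, Measure.map_id]
  congr 1
  · simp
  · ext
    simp [Real.coe_toNNReal _ hv, Real.coe_toNNReal _ (mul_nonneg (sq_nonneg c) hv)]

/-- Delta method in one dimension, through the exact identity
`f Q - f q = dslope f q Q * (Q - q)`. -/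
lemma TendstoInDistribution.delta_method {Q : ℕ → Ω → ℝ} {q v f' : ℝ} {s : ℕ → ℝ} {f : ℝ → ℝ}
    (hv : 0 ≤ v)
    (h : TendstoInDistribution (fun m ω => s m * (Q m ω - q)) atTop (id : ℝ → ℝ) (fun _ => P)
      (gaussianReal 0 v.toNNReal))
    (hQ : ∀ m, Measurable (Q m)) (hlim : ∀ᵐ ω ∂P, Tendsto (fun m => Q m ω) atTop (𝓝 q))
    (hf : Measurable f) (hf' : HasDerivAt f f' q) :
    TendstoInDistribution (fun m ω => s m * (f (Q m ω) - f q)) atTop (id : ℝ → ℝ) (fun _ => P)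
      (gaussianReal 0 (f' ^ 2 * v).toNNReal) := by
  have hmeas : Measurable (dslope f q) := by
    have hslope : Measurable (slope f q) := by
      unfold slope
      simp only [vsub_eq_sub, smul_eq_mul]
      fun_prop
    have : dslope f q = fun x => if x = q then deriv f q else slope f q x := by
      ext x
      split_ifs with h
      · rw [h, dslope_same]
      · rw [dslope_of_ne _ h]
    rw [this]
    exact Measurable.ite (measurableSet_singleton q) measurable_const hslope
  have hcont : Tendsto (dslope f q) (𝓝 q) (𝓝 f') := by
    have := (continuousAt_dslope_same.2 hf'.differentiableAt).tendsto
    rwa [dslope_same, hf'.deriv] at this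
  have h1 := TendstoInDistribution.mul_of_ae_tendsto h
    (Y := fun m ω => dslope f q (Q m ω)) (c := f')
    (fun m => (hmeas.comp (hQ m)).aemeasurable) (by
      filter_upwards [hlim] with ω hω using hcont.comp hω)
  refine TendstoInDistribution.of_map_eq (?_ : TendstoInDistribution _ _ _ _ _)
    aemeasurable_id (map_const_mul_gaussianReal_zero f' v hv)
  refine h1.congr (fun m => ae_of_all _ fun ω => ?_) (ae_of_all _ fun _ => rfl)
  have := sub_smul_dslope f q (Q m ω)
  simp only [smul_eq_mul] at this
  simp only [← this]
  ring

end Convergence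

/-! ### Random linear forms in averages -/

section Linearization

variable {Ω : Type*} [MeasurableSpace Ω] {P : Measure Ω} [IsProbabilityMeasure P]

/-- Asymptotic normality of `s m * T m` when `T m` is, almost surely from some stage on, a linear
form in the centred averages of the i.i.d. vectors `V j` with random coefficients `A m` that
converge almost surely to `a`. The limit is the one for the constant coefficients `a`, which the
scalar central limit theorem for `∑ k, a k * V j k` provides: the remainder is a finite sum of
products of asymptotically normal factors with factors `A m k - a k` tending to `0`. -/
lemma tendstoInDistribution_of_linearization {K : Type*} [Fintype K] {V : ℕ → Ω → K → ℝ}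
    (hindep : iIndepFun V P) (hident : ∀ j, IdentDistrib (V j) (V 0) P P)
    (hV : ∀ k, MemLp (fun ω => V 0 ω k) 2 P)
    {n : ℕ → ℕ} (hn : Tendsto n atTop atTop) {s : ℕ → ℝ} {c : ℝ}
    (hs : Tendsto (fun m => s m / √(n m)) atTop (𝓝 c))
    {a : K → ℝ} {A : ℕ → Ω → K → ℝ} (hA : ∀ m k, Measurable fun ω => A m ω k)
    (hAa : ∀ᵐ ω ∂P, ∀ k, Tendsto (fun m => A m ω k) atTop (𝓝 (a k)))
    {T : ℕ → Ω → ℝ} (hT : ∀ m, Measurable (T m))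
    (hTA : ∀ᵐ ω ∂P, ∀ᶠ m in atTop, T m ω = ∑ k, A m ω k *
      (1 / (n m : ℝ) * ∑ j ∈ Finset.range (n m), V j ω k - ∫ ω', V 0 ω' k ∂P)) :
    TendstoInDistribution (fun m ω => s m * T m ω) atTop (id : ℝ → ℝ) (fun _ => P)
      (gaussianReal 0 (c ^ 2 * Var[fun ω => ∑ k, a k * V 0 ω k; P]).toNNReal) := by
  have clt : ∀ u : (K → ℝ) → ℝ, Measurable u → MemLp (fun ω => u (V 0 ω)) 2 P →
      TendstoInDistribution (fun m ω => (√(n m))⁻¹ * (∑ j ∈ Finset.range (n m), u (V j ω)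
        - n m * ∫ ω', u (V 0 ω') ∂P)) atTop (id : ℝ → ℝ) (fun _ => P)
        (gaussianReal 0 Var[fun ω => u (V 0 ω); P].toNNReal) := by
    intro u hu hu2
    have := tendstoInDistribution_inv_sqrt_mul_sum_sub (P := P) (X := fun j ω => u (V j ω))
      (Y := (id : ℝ → ℝ)) (P' := gaussianReal 0 Var[fun ω => u (V 0 ω); P].toNNReal)
      ⟨aemeasurable_id, Measure.map_id⟩ hu2 (hindep.comp (fun _ => u) fun _ => hu)
      (fun j => (hident j).comp hu)
    exact TendstoInDistribution.comp_tendsto this hn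
  set S : K → ℕ → Ω → ℝ := fun k m ω => (√(n m))⁻¹ * (∑ j ∈ Finset.range (n m), V j ω k
        - n m * ∫ ω', V 0 ω' k ∂P) with hS
  have hSd := fun k => clt (fun x => x k) (measurable_pi_apply k) (hV k)
  have hSm : ∀ k m, AEMeasurable (S k m) P := fun k => (hSd k).forall_aemeasurable
  have hW : TendstoInDistribution (fun m ω => ∑ k, a k * S k m ω) atTop (id : ℝ → ℝ)
      (fun _ => P) (gaussianReal 0 Var[fun ω => ∑ k, a k * V 0 ω k; P].toNNReal) := by
    refine (clt (fun x => ∑ k, a k * x k) (by fun_prop)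
      (memLp_finsetSum _ fun k _ => (hV k).const_mul (a k))).congr
      (fun m => ae_of_all _ fun ω => ?_) (ae_of_all _ fun _ => rfl)
    simp only [hS]
    rw [integral_finsetSum _ fun k _ => ((hV k).integrable (by norm_num)).const_mul (a k),
      Finset.sum_comm, Finset.mul_sum, ← Finset.sum_sub_distrib, Finset.mul_sum]
    refine Finset.sum_congr rfl fun k _ => ?_
    rw [integral_const_mul, ← Finset.mul_sum]
    ring
  have hU : TendstoInDistribution (fun m ω => ∑ k, A m ω k * S k m ω) atTop (id : ℝ → ℝ)
      (fun _ => P) (gaussianReal 0 Var[fun ω => ∑ k, a k * V 0 ω k; P].toNNReal) := by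
    refine tendstoInDistribution_of_tendstoInMeasure_sub _ _ hW ?_ (fun m => by fun_prop)
    have : ∀ k, TendstoInMeasure P (fun m ω => (A m ω k - a k) * S k m ω) atTop 0 := by
      intro k
      refine tendstoInMeasure_zero_of_tendstoInDistribution
        (μ := gaussianReal 0 Var[fun ω => V 0 ω k; P].toNNReal) ?_
      have := TendstoInDistribution.mul_of_ae_tendsto (hSd k) (Y := fun m ω => A m ω k - a k)
        (c := 0) (fun m => ((hA m k).sub_const _).aemeasurable) (by
          filter_upwards [hAa] with ω hω
          simpa using (hω k).sub_const (a k))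
      simpa using this
    convert! TendstoInMeasure.zero_finsetSum Finset.univ this using 2 with m
    ext ω
    simp [sub_mul]
  have hsU := TendstoInDistribution.mul_of_ae_tendsto hU (Y := fun m _ => s m / √(n m))
    (fun m => aemeasurable_const) (ae_of_all _ fun _ => hs)
  refine TendstoInDistribution.of_map_eq (?_ : TendstoInDistribution _ _ _ _ _)
    aemeasurable_id (map_const_mul_gaussianReal_zero c _ (variance_nonneg _ _))
  refine TendstoInDistribution.of_ae_tendsto_sub hsU (fun m => by fun_prop) ?_
  -- for `n m > 0` both sides agree: the centred average is `(√n)⁻¹` times the normalized sum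
  filter_upwards [hTA] with ω hω
  refine tendsto_const_nhds.congr' ?_
  filter_upwards [hω, hn.eventually_gt_atTop 0] with m hm hnm
  have h0 : (0 : ℝ) < n m := by exact_mod_cast hnm
  have hsq : √(n m : ℝ) ≠ 0 := (Real.sqrt_pos.2 h0).ne'
  rw [hm, eq_comm, sub_eq_zero, Finset.mul_sum, Finset.mul_sum]
  refine Finset.sum_congr rfl fun k _ => ?_
  simp only [hS]
  have hsq2 : (n m : ℝ) = √(n m : ℝ) * √(n m : ℝ) := (Real.mul_self_sqrt h0.le).symm
  generalize √(n m : ℝ) = r at hsq hsq2 ⊢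
  rw [hsq2]
  field_simp

end Linearization

/-! ### The exact expansion of the quadratic form -/

section Algebra

variable {d : ℕ}

/-- The vector of all monomials of degree one and two in the coordinates of `y`. -/
def monomials (y : Fin d → ℝ) : Fin d ⊕ Fin d × Fin d → ℝ :=
  Sum.elim y (kronVec y y)

/-- The empirical means of the monomials over the observations `x 0, …, x (m - 1)`. -/
noncomputable def sampleMoment (m : ℕ) (x : ℕ → Fin d → ℝ) (k : Fin d ⊕ Fin d × Fin d) : ℝ :=
  1 / (m : ℝ) * ∑ j ∈ Finset.range m, monomials (x j) k

/-- The coefficients of the exact expansion of `quad y S - quad x T` in the differences of first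
and second moments, where `u = y S⁻¹` and `w = x T⁻¹`; on the diagonal `y = x`, `u = w` they are
the entries of the gradient `rowA`. -/
def secantCoeff (y u x w : Fin d → ℝ) : Fin d ⊕ Fin d × Fin d → ℝ :=
  Sum.elim (fun r => u r + w r + (y ⬝ᵥ w) * u r + (u ⬝ᵥ x) * w r)
    (fun p => -(u p.1 * w p.2))

lemma secantCoeff_diag (x : Fin d → ℝ) (S : Matrix (Fin d) (Fin d) ℝ) :
    secantCoeff x (Matrix.vecMul x S⁻¹) x (Matrix.vecMul x S⁻¹) = rowA x S := by
  unfold secantCoeff rowA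
  set w := Matrix.vecMul x S⁻¹
  ext k
  rcases k with s | p
  · have hD : ∀ p : Fin d × Fin d, Dtilde x p s =
        -(if p.1 = s then x p.2 else 0) - (if p.2 = s then x p.1 else 0) := by
      rintro ⟨a, r⟩
      simp only [Dtilde, Matrix.of_apply]
      by_cases h1 : s = a <;> by_cases h2 : s = r <;> grind
    have : Matrix.vecMul (kronVec w w) (Dtilde x) s = -(2 * (x ⬝ᵥ w) * w s) := by
      simp only [Matrix.vecMul, dotProduct, kronVec, hD, Fintype.sum_prod_type, mul_sub, mul_neg,
        Finset.sum_sub_distrib, Finset.sum_neg_distrib, mul_ite, mul_zero]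
      rw [Finset.sum_comm]
      simp only [Finset.sum_ite_eq', Finset.mem_univ, if_true, mul_assoc,
        ← Finset.mul_sum]
      simp only [Finset.mul_sum, Finset.sum_mul, ← Finset.sum_neg_distrib,
        ← Finset.sum_sub_distrib]
      refine Finset.sum_congr rfl fun i _ => ?_
      ring
    simp only [Sum.elim_inl, Pi.sub_apply, Pi.smul_apply, smul_eq_mul, this,
      dotProduct_comm w x]
    ring
  · simp [kronVec]

lemma quad_eq_dotProduct (x : Fin d → ℝ) (S : Matrix (Fin d) (Fin d) ℝ) :
    quad x S = Matrix.vecMul x S⁻¹ ⬝ᵥ x := by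
  rw [quad, Matrix.dotProduct_mulVec]

/-- With `u = y S⁻¹` and `w = x T⁻¹` one has
`u y - w x = (u + w)(y - x) - u (S - T) w`; inserting `S = M - y yᵀ` and `T = L - x xᵀ` makes the
right-hand side linear in `y - x` and `M - L`. -/
lemma quad_sub_quad {x y : Fin d → ℝ} {S T : Matrix (Fin d) (Fin d) ℝ}
    {θ η : Fin d ⊕ Fin d × Fin d → ℝ} (hS : IsUnit S.det) (hT : IsUnit T.det)
    (hTs : T.transpose = T) (hy : ∀ r, η (Sum.inl r) = y r) (hx : ∀ r, θ (Sum.inl r) = x r)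
    (hSη : ∀ a r, S a r = η (Sum.inr (a, r)) - y a * y r)
    (hTθ : ∀ a r, T a r = θ (Sum.inr (a, r)) - x a * x r) :
    quad y S - quad x T = ∑ k, secantCoeff y (Matrix.vecMul y S⁻¹) x (Matrix.vecMul x T⁻¹) k *
      (η k - θ k) := by
  rw [quad_eq_dotProduct, quad_eq_dotProduct]
  set u := Matrix.vecMul y S⁻¹ with hu
  set w := Matrix.vecMul x T⁻¹ with hw
  have huS : Matrix.vecMul u S = y := by
    rw [hu, Matrix.vecMul_vecMul, Matrix.nonsing_inv_mul _ hS, Matrix.vecMul_one]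
  have hTw : Matrix.mulVec T w = x := by
    rw [← hTs, Matrix.mulVec_transpose, hw, Matrix.vecMul_vecMul, Matrix.nonsing_inv_mul _ hT,
      Matrix.vecMul_one]
  have h1 : u ⬝ᵥ Matrix.mulVec S w = y ⬝ᵥ w := by rw [Matrix.dotProduct_mulVec, huS]
  have h2 : u ⬝ᵥ Matrix.mulVec T w = u ⬝ᵥ x := by rw [hTw]
  have expand : ∀ (R : Matrix (Fin d) (Fin d) ℝ) (ζ : Fin d ⊕ Fin d × Fin d → ℝ) (z : Fin d → ℝ),
      (∀ a r, R a r = ζ (Sum.inr (a, r)) - z a * z r) → u ⬝ᵥ Matrix.mulVec R w =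
        (∑ p : Fin d × Fin d, u p.1 * w p.2 * ζ (Sum.inr p)) - (u ⬝ᵥ z) * (z ⬝ᵥ w) := by
    intro R ζ z hR
    rw [dotProduct, dotProduct, dotProduct, Finset.sum_mul_sum, Fintype.sum_prod_type,
      ← Finset.sum_sub_distrib]
    simp only [dotProduct, Matrix.mulVec, hR, ← Finset.sum_sub_distrib, Finset.mul_sum]
    refine Finset.sum_congr rfl fun a _ => Finset.sum_congr rfl fun r _ => ?_
    ring
  rw [expand S η y hSη] at h1
  rw [expand T θ x hTθ] at h2
  have e1 : ∑ r, secantCoeff y u x w (Sum.inl r) * (η (Sum.inl r) - θ (Sum.inl r)) =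
      u ⬝ᵥ y - u ⬝ᵥ x + (y ⬝ᵥ w - x ⬝ᵥ w) + (y ⬝ᵥ w) * (u ⬝ᵥ y - u ⬝ᵥ x)
        + (u ⬝ᵥ x) * (y ⬝ᵥ w - x ⬝ᵥ w) := by
    simp only [secantCoeff, Sum.elim_inl, hy, hx]
    change (u + w + (y ⬝ᵥ w) • u + (u ⬝ᵥ x) • w) ⬝ᵥ (y - x) = _
    simp only [add_dotProduct, smul_dotProduct, dotProduct_sub, smul_eq_mul,
      dotProduct_comm w]
    ring
  have e2 : ∑ p, secantCoeff y u x w (Sum.inr p) * (η (Sum.inr p) - θ (Sum.inr p)) =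
      (∑ p : Fin d × Fin d, u p.1 * w p.2 * θ (Sum.inr p)) -
        ∑ p : Fin d × Fin d, u p.1 * w p.2 * η (Sum.inr p) := by
    rw [← Finset.sum_sub_distrib]
    refine Finset.sum_congr rfl fun p _ => ?_
    simp only [secantCoeff, Sum.elim_inr]
    ring
  rw [Fintype.sum_sum_type, e1, e2, dotProduct_comm w x]
  linear_combination h1 - h2

lemma sampleCov_eq (m : ℕ) (x : ℕ → Fin d → ℝ) (a r : Fin d) :
    sampleCov m x a r = sampleMoment m x (Sum.inr (a, r)) - sampleMean m x a * sampleMean m x r := by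
  rcases Nat.eq_zero_or_pos m with rfl | hm
  · simp [sampleCov, sampleMoment, sampleMean]
  have hm' : (m : ℝ) ≠ 0 := by positivity
  have h : ∀ s, ∑ j ∈ Finset.range m, x j s = m * sampleMean m x s := fun s => by
    rw [sampleMean]; field_simp
  simp only [sampleCov, Matrix.of_apply, sampleMoment, monomials, Sum.elim_inr, kronVec]
  have : ∀ j, (x j a - sampleMean m x a) * (x j r - sampleMean m x r) =
      x j a * x j r - sampleMean m x r * x j a - sampleMean m x a * x j r
        + sampleMean m x a * sampleMean m x r := fun j => by ring
  simp only [this, Finset.sum_add_distrib, Finset.sum_sub_distrib, ← Finset.mul_sum, h,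
    Finset.sum_const, Finset.card_range, nsmul_eq_mul]
  field_simp
  ring

end Algebra

/-! ### Continuity and measurability of the matrix inverse -/

section Inverse

variable {d : ℕ}

lemma tendsto_matrix_inv {S : ℕ → Matrix (Fin d) (Fin d) ℝ} {T : Matrix (Fin d) (Fin d) ℝ}
    (hT : IsUnit T.det) (h : Tendsto S atTop (𝓝 T)) :
    Tendsto (fun m => (S m)⁻¹) atTop (𝓝 T⁻¹) := by
  have hdet : Tendsto (fun m => (S m).det) atTop (𝓝 T.det) :=
    ((continuous_id.matrix_det).tendsto T).comp h
  have hadj : Tendsto (fun m => (S m).adjugate) atTop (𝓝 T.adjugate) :=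
    ((continuous_id.matrix_adjugate).tendsto T).comp h
  simp only [Matrix.inv_def, Ring.inverse_eq_inv']
  exact (hdet.inv₀ hT.ne_zero).smul hadj

lemma measurable_matrix_inv {Ω : Type*} [MeasurableSpace Ω] {S : Ω → Matrix (Fin d) (Fin d) ℝ}
    (h : ∀ a r, Measurable fun ω => S ω a r) (a r : Fin d) :
    Measurable fun ω => (S ω)⁻¹ a r := by
  have hdet : ∀ R : Ω → Matrix (Fin d) (Fin d) ℝ, (∀ a r, Measurable fun ω => R ω a r) →
      Measurable fun ω => (R ω).det := by
    intro R hR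
    simp only [Matrix.det_apply]
    exact Finset.measurable_fun_sum _ fun σ _ =>
      (Finset.measurable_fun_prod _ fun i _ => hR _ _).const_smul _
  simp only [Matrix.inv_def, Ring.inverse_eq_inv', Matrix.smul_apply, smul_eq_mul,
    Matrix.adjugate_apply]
  refine (hdet S h).inv.mul (hdet _ fun b c => ?_)
  simp only [Matrix.updateRow_apply]
  split_ifs
  · exact measurable_const
  · exact h b c

end Inverse

/-! ### Moments of the monomials -/

section Moments

variable {Ω : Type*} [MeasurableSpace Ω] {P : Measure Ω} [IsProbabilityMeasure P] {d : ℕ}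
  {Y : Ω → Fin d → ℝ}

lemma measurable_monomials (k : Fin d ⊕ Fin d × Fin d) :
    Measurable fun y : Fin d → ℝ => monomials y k := by
  rcases k with r | p
  · exact measurable_pi_apply r
  · exact (measurable_pi_apply p.1).mul (measurable_pi_apply p.2)

lemma memLp_monomials (hY : Measurable Y) (hmom : ∀ r, Integrable (fun ω => (Y ω r) ^ 4) P)
    (k : Fin d ⊕ Fin d × Fin d) : MemLp (fun ω => monomials (Y ω) k) 2 P := by
  have hYr : ∀ r, Measurable fun ω => Y ω r := fun r => (measurable_pi_apply r).comp hY
  have hm : Measurable fun ω => monomials (Y ω) k := (measurable_monomials k).comp hY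
  rw [memLp_two_iff_integrable_sq hm.aestronglyMeasurable]
  rcases k with r | ⟨a, r⟩
  · refine Integrable.mono' ((integrable_const (1 : ℝ)).add (hmom r))
      (hm.pow_const 2).aestronglyMeasurable (ae_of_all _ fun ω => ?_)
    simp only [monomials, Sum.elim_inl, Pi.add_apply, Real.norm_eq_abs]
    rw [abs_of_nonneg (by positivity)]
    nlinarith [sq_nonneg (Y ω r ^ 2 - 1), sq_nonneg (Y ω r)]
  · refine Integrable.mono' ((hmom a).add (hmom r))
      (hm.pow_const 2).aestronglyMeasurable (ae_of_all _ fun ω => ?_)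
    simp only [monomials, Sum.elim_inr, kronVec, Pi.add_apply, Real.norm_eq_abs]
    rw [abs_of_nonneg (by positivity)]
    nlinarith [sq_nonneg (Y ω a ^ 2 - Y ω r ^ 2), sq_nonneg (Y ω a ^ 2 + Y ω r ^ 2)]

lemma covMat_apply_eq (h : ∀ k, MemLp (fun ω => monomials (Y ω) k) 2 P) (a r : Fin d) :
    covMat Y P a r = (∫ ω, monomials (Y ω) (Sum.inr (a, r)) ∂P) - mean Y P a * mean Y P r := by
  exact covariance_eq_sub (h (Sum.inl a)) (h (Sum.inl r))

lemma jointCov_apply_eq (h : ∀ k, MemLp (fun ω => monomials (Y ω) k) 2 P)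
    (k l : Fin d ⊕ Fin d × Fin d) : jointCov Y P k l =
      cov[fun ω => monomials (Y ω) k, fun ω => monomials (Y ω) l; P] := by
  rcases k with r | p <;> rcases l with s | q
  · rfl
  · rw [covariance_comm, covariance_eq_sub (h (Sum.inr q)) (h (Sum.inl r))]
    rfl
  · rw [covariance_eq_sub (h (Sum.inr p)) (h (Sum.inl s))]
    rfl
  · rw [covariance_eq_sub (h (Sum.inr p)) (h (Sum.inr q))]
    simp only [jointCov, Matrix.fromBlocks_apply₂₂, Psi4, Matrix.of_apply, Pi.mul_apply,
      monomials, Sum.elim_inr, kronVec, mul_assoc]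

lemma variance_sum_mul {K : Type*} [Fintype K] {V : K → Ω → ℝ} (hV : ∀ k, MemLp (V k) 2 P)
    (a : K → ℝ) : Var[fun ω => ∑ k, a k * V k ω; P] =
      Matrix.vecMul a (Matrix.of fun k l => cov[V k, V l; P]) ⬝ᵥ a := by
  have hs : AEMeasurable (fun ω => ∑ k, a k * V k ω) P := by
    have := fun k => (hV k).aestronglyMeasurable.aemeasurable
    fun_prop
  rw [← covariance_self hs, covariance_fun_sum_fun_sum (fun k => (hV k).const_mul (a k))
    (fun k => (hV k).const_mul (a k))]
  simp only [covariance_const_mul_left, covariance_const_mul_right, Matrix.vecMul, dotProduct,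
    Matrix.of_apply, Finset.sum_mul]
  rw [Finset.sum_comm]
  refine Finset.sum_congr rfl fun k _ => Finset.sum_congr rfl fun l _ => ?_
  ring

lemma covMat_posSemidef (h : ∀ r, MemLp (fun ω => Y ω r) 2 P) : (covMat Y P).PosSemidef := by
  refine .of_dotProduct_mulVec_nonneg ?_ fun x => ?_
  · ext r s
    simp [covMat, covariance_comm]
  · have := variance_nonneg (fun ω => ∑ r, x r * Y ω r) P
    rw [variance_sum_mul h x, ← Matrix.dotProduct_mulVec] at this
    rwa [star_trivial]

lemma quad_mean_pos (h : ∀ r, MemLp (fun ω => Y ω r) 2 P) (hcov : IsUnit (covMat Y P))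
    (hmean : mean Y P ≠ 0) : 0 < quad (mean Y P) (covMat Y P) := by
  have hpd := ((covMat_posSemidef h).posDef_iff_isUnit.2 hcov).inv
  simpa [quad] using hpd.dotProduct_mulVec_pos hmean

lemma vecMul_jointCov_dotProduct (h : ∀ k, MemLp (fun ω => monomials (Y ω) k) 2 P)
    (a : Fin d ⊕ Fin d × Fin d → ℝ) : Matrix.vecMul a (jointCov Y P) ⬝ᵥ a =
      Var[fun ω => ∑ k, a k * monomials (Y ω) k; P] := by
  rw [variance_sum_mul h a]
  congr 2
  ext k l
  rw [jointCov_apply_eq h, Matrix.of_apply]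

end Moments

/-! ### Asymptotics of the plug-in quadratic form -/

section Sampling

variable {Ω : Type*} [MeasurableSpace Ω] {P : Measure Ω} [IsProbabilityMeasure P] {d : ℕ}
  {Y : ℕ → Ω → Fin d → ℝ}

lemma ae_tendsto_sampleMoment (hmeas : ∀ j, Measurable (Y j)) (hindep : iIndepFun Y P)
    (hident : ∀ j, IdentDistrib (Y j) (Y 0) P P)
    (hmom : ∀ r, Integrable (fun ω => (Y 0 ω r) ^ 4) P) :
    ∀ᵐ ω ∂P, ∀ k, Tendsto (fun n => sampleMoment n (fun j => Y j ω) k) atTop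
      (𝓝 (∫ ω', monomials (Y 0 ω') k ∂P)) := by
  rw [ae_all_iff]
  intro k
  have h := strong_law_ae_real (μ := P) (fun j ω => monomials (Y j ω) k)
    ((memLp_monomials (hmeas 0) hmom k).integrable (by norm_num))
    (fun i j hij => (hindep.indepFun hij).comp (measurable_monomials k) (measurable_monomials k))
    (fun j => (hident j).comp (measurable_monomials k))
  filter_upwards [h] with ω hω
  refine hω.congr fun n => ?_
  rw [sampleMoment, one_div, ← div_eq_inv_mul]

lemma tendsto_sampleCov {x : ℕ → Fin d → ℝ} {θ : Fin d ⊕ Fin d × Fin d → ℝ}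
    {T : Matrix (Fin d) (Fin d) ℝ}
    (h : ∀ k, Tendsto (fun n => sampleMoment n x k) atTop (𝓝 (θ k)))
    (hT : ∀ a r, T a r = θ (Sum.inr (a, r)) - θ (Sum.inl a) * θ (Sum.inl r)) :
    Tendsto (fun n => sampleCov n x) atTop (𝓝 T) := by
  refine tendsto_pi_nhds.2 fun a => tendsto_pi_nhds.2 fun r => ?_
  simp only [sampleCov_eq, hT]
  exact (h _).sub ((h (Sum.inl a)).mul (h (Sum.inl r)))

lemma tendsto_vecMul_inv {x : ℕ → Fin d → ℝ} {y : Fin d → ℝ}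
    {S : ℕ → Matrix (Fin d) (Fin d) ℝ} {T : Matrix (Fin d) (Fin d) ℝ}
    (hx : Tendsto x atTop (𝓝 y)) (hS : Tendsto S atTop (𝓝 T)) (hT : IsUnit T.det) :
    Tendsto (fun n => Matrix.vecMul (x n) (S n)⁻¹) atTop (𝓝 (Matrix.vecMul y T⁻¹)) := by
  have hc : Continuous fun p : (Fin d → ℝ) × Matrix (Fin d) (Fin d) ℝ => Matrix.vecMul p.1 p.2 :=
    continuous_fst.matrix_vecMul continuous_snd
  exact (hc.tendsto (y, T⁻¹)).comp (hx.prodMk_nhds (tendsto_matrix_inv hT hS))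

lemma tendsto_dotProduct {x y : ℕ → Fin d → ℝ} {x' y' : Fin d → ℝ}
    (hx : Tendsto x atTop (𝓝 x')) (hy : Tendsto y atTop (𝓝 y')) :
    Tendsto (fun n => x n ⬝ᵥ y n) atTop (𝓝 (x' ⬝ᵥ y')) :=
  tendsto_finsetSum _ fun r _ => (tendsto_pi_nhds.1 hx r).mul (tendsto_pi_nhds.1 hy r)

lemma measurable_sampleMean (hmeas : ∀ j, Measurable (Y j)) (n : ℕ) (r : Fin d) :
    Measurable fun ω => sampleMean n (fun j => Y j ω) r := by
  have : ∀ j, Measurable fun ω => Y j ω r := fun j => (measurable_pi_apply r).comp (hmeas j)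
  unfold sampleMean
  fun_prop

lemma measurable_sampleCov (hmeas : ∀ j, Measurable (Y j)) (n : ℕ) (a r : Fin d) :
    Measurable fun ω => sampleCov n (fun j => Y j ω) a r := by
  have h1 : ∀ j s, Measurable fun ω => Y j ω s := fun j s => (measurable_pi_apply s).comp (hmeas j)
  have h2 := measurable_sampleMean hmeas n
  simp only [sampleCov, Matrix.of_apply]
  fun_prop

lemma measurable_vecMul_inv (hmeas : ∀ j, Measurable (Y j)) (n : ℕ) (r : Fin d) :
    Measurable fun ω => Matrix.vecMul (sampleMean n (fun j => Y j ω))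
      (sampleCov n (fun j => Y j ω))⁻¹ r := by
  simp only [Matrix.vecMul, dotProduct]
  exact Finset.measurable_fun_sum _ fun a _ => (measurable_sampleMean hmeas n a).mul
    (measurable_matrix_inv (measurable_sampleCov hmeas n) a r)

lemma measurable_quad_sample (hmeas : ∀ j, Measurable (Y j)) (n : ℕ) :
    Measurable fun ω => quad (sampleMean n (fun j => Y j ω)) (sampleCov n (fun j => Y j ω)) := by
  simp only [quad_eq_dotProduct, dotProduct]
  exact Finset.measurable_fun_sum _ fun a _ =>
    (measurable_vecMul_inv hmeas n a).mul (measurable_sampleMean hmeas n a)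

lemma measurable_secantCoeff (hmeas : ∀ j, Measurable (Y j)) (n : ℕ) (x w : Fin d → ℝ)
    (k : Fin d ⊕ Fin d × Fin d) :
    Measurable fun ω => secantCoeff (sampleMean n (fun j => Y j ω))
      (Matrix.vecMul (sampleMean n (fun j => Y j ω)) (sampleCov n (fun j => Y j ω))⁻¹) x w k := by
  have h1 := measurable_sampleMean hmeas n
  have h2 := measurable_vecMul_inv hmeas n
  rcases k with r | p
  · simp only [secantCoeff, Sum.elim_inl, dotProduct]
    fun_prop
  · simp only [secantCoeff, Sum.elim_inr]
    fun_prop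

lemma tendsto_secantCoeff {y u : ℕ → Fin d → ℝ} {x w : Fin d → ℝ}
    (hy : Tendsto y atTop (𝓝 x)) (hu : Tendsto u atTop (𝓝 w)) (k : Fin d ⊕ Fin d × Fin d) :
    Tendsto (fun n => secantCoeff (y n) (u n) x w k) atTop (𝓝 (secantCoeff x w x w k)) := by
  have hu' := tendsto_pi_nhds.1 hu
  rcases k with r | p
  · simp only [secantCoeff, Sum.elim_inl]
    exact (((hu' r).add_const _).add ((tendsto_dotProduct hy tendsto_const_nhds).mul (hu' r))).add
      ((tendsto_dotProduct hu tendsto_const_nhds).mul_const _)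
  · simp only [secantCoeff, Sum.elim_inr]
    exact ((hu' p.1).mul_const _).neg

/-- Strong consistency of the plug-in estimator of `quad`, together with its asymptotic normality.
The variance is that of the gradient `rowA` applied to the vector of monomials. -/
lemma quad_sample_asymptotics (hmeas : ∀ j, Measurable (Y j)) (hindep : iIndepFun Y P)
    (hident : ∀ j, IdentDistrib (Y j) (Y 0) P P)
    (hmom : ∀ r, Integrable (fun ω => (Y 0 ω r) ^ 4) P) (hcov : IsUnit (covMat (Y 0) P))
    {n : ℕ → ℕ} (hn : Tendsto n atTop atTop) {s : ℕ → ℝ} {c : ℝ}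
    (hs : Tendsto (fun m => s m / √(n m)) atTop (𝓝 c)) :
    (∀ᵐ ω ∂P, Tendsto (fun m => quad (sampleMean (n m) (fun j => Y j ω))
      (sampleCov (n m) (fun j => Y j ω))) atTop (𝓝 (quad (mean (Y 0) P) (covMat (Y 0) P)))) ∧
    TendstoInDistribution (fun m ω => s m * (quad (sampleMean (n m) (fun j => Y j ω))
      (sampleCov (n m) (fun j => Y j ω)) - quad (mean (Y 0) P) (covMat (Y 0) P)))
      atTop (id : ℝ → ℝ) (fun _ => P) (gaussianReal 0 (c ^ 2 *
        (Matrix.vecMul (rowA (mean (Y 0) P) (covMat (Y 0) P)) (jointCov (Y 0) P) ⬝ᵥ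
          rowA (mean (Y 0) P) (covMat (Y 0) P))).toNNReal) := by
  have hL := memLp_monomials (hmeas 0) hmom
  have hdet : IsUnit (covMat (Y 0) P).det := (Matrix.isUnit_iff_isUnit_det _).1 hcov
  have hlim : ∀ᵐ ω ∂P, (∀ k, Tendsto (fun m => sampleMoment m (fun j => Y j ω) k) atTop
        (𝓝 (∫ ω', monomials (Y 0 ω') k ∂P))) ∧
      Tendsto (fun m => sampleMean m (fun j => Y j ω)) atTop (𝓝 (mean (Y 0) P)) ∧
      Tendsto (fun m => sampleCov m (fun j => Y j ω)) atTop (𝓝 (covMat (Y 0) P)) := by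
    filter_upwards [ae_tendsto_sampleMoment hmeas hindep hident hmom] with ω hω
    exact ⟨hω, tendsto_pi_nhds.2 fun r => hω (Sum.inl r),
      tendsto_sampleCov hω (covMat_apply_eq hL)⟩
  refine ⟨?_, ?_⟩
  · filter_upwards [hlim] with ω ⟨_, h1, h2⟩
    simp only [quad_eq_dotProduct]
    exact (tendsto_dotProduct (tendsto_vecMul_inv h1 h2 hdet) h1).comp hn
  · rw [vecMul_jointCov_dotProduct hL]
    refine tendstoInDistribution_of_linearization
      (hindep.comp (fun _ => monomials) fun _ => measurable_pi_iff.2 measurable_monomials)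
      (fun j => (hident j).comp (measurable_pi_iff.2 measurable_monomials)) hL hn hs
      (A := fun m ω => secantCoeff (sampleMean (n m) (fun j => Y j ω))
        (Matrix.vecMul (sampleMean (n m) (fun j => Y j ω)) (sampleCov (n m) (fun j => Y j ω))⁻¹)
        (mean (Y 0) P) (Matrix.vecMul (mean (Y 0) P) (covMat (Y 0) P)⁻¹))
      (fun m k => measurable_secantCoeff hmeas (n m) _ _ k) ?_
      (fun m => (measurable_quad_sample hmeas (n m)).sub_const _) ?_
    · filter_upwards [hlim] with ω ⟨_, h1, h2⟩ k
      rw [← secantCoeff_diag]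
      exact (tendsto_secantCoeff h1 (tendsto_vecMul_inv h1 h2 hdet) k).comp hn
    · filter_upwards [hlim] with ω ⟨_, _, h2⟩
      -- the sample covariance matrix is eventually invertible, as its determinant converges
      have hev : ∀ᶠ m in atTop, (sampleCov m (fun j => Y j ω)).det ≠ 0 :=
        (((continuous_id.matrix_det).tendsto _).comp h2).eventually_ne hdet.ne_zero
      filter_upwards [hn.eventually hev] with m hm
      exact quad_sub_quad (isUnit_iff_ne_zero.2 hm) hdet
        ((covMat_posSemidef fun r => hL (Sum.inl r)).1) (fun _ => rfl) (fun _ => rfl)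
        (sampleCov_eq _ _) (covMat_apply_eq hL)

end Sampling

end MCV

theorem theorem1 {Ω : Type*} [MeasurableSpace Ω] (P : Measure Ω) [IsProbabilityMeasure P]
    {ι : Type*} [Fintype ι] {d : ℕ}
    -- `X i j` is the `j`-th observation in group `i`
    (X : ι → ℕ → Ω → Fin d → ℝ)
    (hmeas : ∀ i j, Measurable (X i j))
    (hindep : iIndepFun (fun p : ι × ℕ => X p.1 p.2) P)
    (hident : ∀ i j, IdentDistrib (X i j) (X i 0) P P)
    (hmom : ∀ i r, Integrable (fun ω => (X i 0 ω r) ^ 4) P)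
    (hmean : ∀ i, MCV.mean (X i 0) P ≠ 0)
    (hcov : ∀ i, IsUnit (MCV.covMat (X i 0) P))
    -- `N m i` is the size of group `i` at stage `m`; the total size tends to infinity
    (N : ℕ → ι → ℕ)
    (hN : Tendsto (fun m => ∑ i, N m i) atTop atTop)
    (κ : ι → ℝ) (hκ : ∀ i, κ i ∈ Set.Ioo (0 : ℝ) 1)
    (hNκ : ∀ i, Tendsto (fun m => (N m i : ℝ) / ((∑ l, N m l : ℕ) : ℝ)) atTop (𝓝 (κ i)))
    (i : ι) :
    (0 ≤ MCV.asympVarC (X i 0) P (κ i) ∧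
      TendstoInDistribution
        (fun (m : ℕ) (ω : Ω) => √((∑ l, N m l : ℕ) : ℝ) *
          (MCV.estC (N m i) (fun j => X i j ω) -
            MCV.coefVar (MCV.mean (X i 0) P) (MCV.covMat (X i 0) P)))
        atTop (id : ℝ → ℝ) (fun _ => P)
        (gaussianReal 0 (MCV.asympVarC (X i 0) P (κ i)).toNNReal)) ∧
    (0 ≤ MCV.asympVarB (X i 0) P (κ i) ∧
      TendstoInDistribution
        (fun (m : ℕ) (ω : Ω) => √((∑ l, N m l : ℕ) : ℝ) *
          (MCV.estB (N m i) (fun j => X i j ω) -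
            MCV.stdMean (MCV.mean (X i 0) P) (MCV.covMat (X i 0) P)))
        atTop (id : ℝ → ℝ) (fun _ => P)
        (gaussianReal 0 (MCV.asympVarB (X i 0) P (κ i)).toNNReal)) := by
  have hκ0 : 0 < κ i := (hκ i).1
  have hNR : Tendsto (fun m => ((∑ l, N m l : ℕ) : ℝ)) atTop atTop :=
    tendsto_natCast_atTop_atTop.comp hN
  -- the group size itself tends to infinity, because its limiting proportion is positive
  have hn : Tendsto (fun m => N m i) atTop atTop := by
    rw [← tendsto_natCast_atTop_iff (R := ℝ)]
    refine ((hNκ i).pos_mul_atTop hκ0 hNR).congr' ?_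
    filter_upwards [hNR.eventually_gt_atTop 0] with m hm
    field_simp
  have hs : Tendsto (fun m => √((∑ l, N m l : ℕ) : ℝ) / √(N m i : ℝ)) atTop
      (𝓝 (√(κ i)⁻¹)) := by
    refine ((hNκ i).inv₀ hκ0.ne').sqrt.congr fun m => ?_
    rw [inv_div, Real.sqrt_div (Nat.cast_nonneg _)]
  have hind : iIndepFun (fun j => X i j) P :=
    hindep.precomp (g := fun j : ℕ => (i, j)) fun a b h => (Prod.mk.inj h).2
  have hL := MCV.memLp_monomials (hmeas i 0) (hmom i)
  have hq : 0 < MCV.quad (MCV.mean (X i 0) P) (MCV.covMat (X i 0) P) :=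
    MCV.quad_mean_pos (fun r => hL (Sum.inl r)) (hcov i) (hmean i)
  obtain ⟨hlim, hdist⟩ :=
    MCV.quad_sample_asymptotics (hmeas i) hind (hident i) (hmom i) (hcov i) hn hs
  have hv := variance_nonneg (fun ω => ∑ k, MCV.rowA (MCV.mean (X i 0) P)
    (MCV.covMat (X i 0) P) k * MCV.monomials (X i 0 ω) k) P
  rw [← MCV.vecMul_jointCov_dotProduct hL] at hv
  have hQ := fun m => MCV.measurable_quad_sample (hmeas i) (N m i)
  unfold MCV.asympVarB MCV.asympVarC MCV.estB MCV.estC MCV.coefVar MCV.stdMean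
  rw [Real.sq_sqrt (inv_nonneg.2 hκ0.le)] at hdist
  generalize Matrix.vecMul (MCV.rowA (MCV.mean (X i 0) P) (MCV.covMat (X i 0) P))
    (MCV.jointCov (X i 0) P) ⬝ᵥ MCV.rowA (MCV.mean (X i 0) P) (MCV.covMat (X i 0) P) = v
    at hv hdist ⊢
  generalize MCV.quad (MCV.mean (X i 0) P) (MCV.covMat (X i 0) P) = q at hq hlim hdist ⊢
  have hv' : 0 ≤ (κ i)⁻¹ * v := by positivity
  have hsq : √q ≠ 0 := (Real.sqrt_pos.2 hq).ne'
  have hq2 : √q ^ 2 = q := Real.sq_sqrt hq.le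
  have dB : HasDerivAt (fun x => √x) (1 / (2 * √q)) q := Real.hasDerivAt_sqrt hq.ne'
  have dC : HasDerivAt (fun x => 1 / √x) (-(1 / (2 * √q)) / √q ^ 2) q := by
    simpa only [one_div] using dB.fun_inv hsq
  -- `d√q = dq / (2√q)` and `d(1/√q) = -dq / (2 q √q)`, squared
  have eB : (1 / (2 * √q)) ^ 2 * ((κ i)⁻¹ * v) = q ^ 2 * (1 / (4 * κ i) * q ^ (-3 : ℤ) * v) := by
    rw [div_pow, mul_pow, hq2, zpow_neg]
    norm_cast
    field_simp
    ring
  have eC : (-(1 / (2 * √q)) / √q ^ 2) ^ 2 * ((κ i)⁻¹ * v) =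
      1 / (4 * κ i) * q ^ (-3 : ℤ) * v := by
    rw [hq2, div_pow, neg_sq, div_pow, mul_pow, hq2, zpow_neg]
    norm_cast
    field_simp
    ring
  refine ⟨⟨by positivity, ?_⟩, ⟨by positivity, ?_⟩⟩
  · rw [← eC]
    exact MCV.TendstoInDistribution.delta_method (f := fun x => 1 / √x) hv' hdist hQ hlim
      (by fun_prop) dC
  · rw [← eB]
    exact MCV.TendstoInDistribution.delta_method (f := fun x => √x) hv' hdist hQ hlim
      (by fun_prop) dB
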